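/- Conventions. For a real sequence \(c=(c_1,c_2,\dots)\) let \(B_{n,k}(c)\) be the partial Bell polynomials, defined by \(\sum_{n\ge k}B_{n,k}(c)\frac{t^n}{n!}=\frac1{k!}\bigl(\sum_{m\ge1}c_m\frac{t^m}{m!}\bigr)^k\), and let \(A_n(c)=\sum_{k=1}^nB_{n,k}(c)\) for \(n\ge1\), \(A_0(c)=1\), be the complete Bell polynomials. Let \((f_n)_{n\ge0}\) be a sequence of real polynomials of binomial type with \(f_0=1\), that is, \(f_n(x+y)=\sum_{k=0}^n\binom nk f_k(x)f_{n-k}(y)\) for all \(n\) and all real \(x,y\). For real \(a\) put \(f_n(x;a)=\frac{x}{an+x}f_n(an+x)\) (a polynomial in \(x\)), \(f_0(x;a)=1\). \(D^m_{z=w}\) denotes the \(m\)-th derivative with respect to \(z\), evaluated at \(z=w\). Theorem. Let \((a_i)_{i\ge1}\) be a real sequence, let \(n,r,s,u,v\ge0\) be integers with \(r\ge1\) and \(nr+s\ge1\), and let \(x,a,\alpha,\beta,\lambda\) be real numbers. Write \(\varphi(y)=\sum_{i\ge1}a_i\frac{y^i}{i!}\), and for integers \(m,q\ge0\) with \(mr+q\ge1\)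 put \(R(m,q)=mr+q\) and define \(Z(m,q)\) as follows. (1) Let \(\alpha\ne0\), put \(\gamma:=\alpha^v\varphi(x\alpha^u)\) and, with \(R=R(m,q)\), \[ Z(m,q):=\frac{R!}{\gamma^{q}R}\sum_{j\ge R}B_{j,R}(a_1,a_2,\dots)\,D_{z=0}^{ju+vR}\bigl\{e^{\alpha z}f_m(\beta j+\lambda R+z;a)\bigr\}\frac{x^j}{j!}. \] If the power series \(\varphi\) converges at some real \(\rho\) with \(|\rho|>|x\alpha^u|\), then the series for \(\varphi(x\alpha^u)\) converges and all the series in the definition of the \(Z(m,q)\) converge absolutely. Whenever the series for \(\varphi(x\alpha^u)\) and the series in \(Z(1,0),\dots,Z(n,0)\) and \(Z(n,s)\) converge and \(\gamma\ne0\), \[ A_n\bigl(sZ(1,0),sZ(2,0),\dots,sZ(n,0)\bigr)=sZ(n,s). \] (2) For \(\alpha=0\) the same equation holds for \[ Z(m,q):=\frac{m!\,R!}{\gamma^{q}R}\sum_{j=R}^{g+R}B_{j,R}(a_1,a_2,\dots)\,\frac{D_{z=\beta j+\lambda R}^{ju+vR}f_{m+(u+v)R}(z;a)}{(m+(u+v)R)!}\,\frac{x^j}{j!},\qquad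 R=R(m,q), \] where \(g=\lfloor m/u\rfloor\) and \(\gamma=a_1x\,f_1'(0)^{u+v}\) if \(u\ge1\), while \(g=\infty\) and \(\gamma=f_1'(0)^v\varphi(x)\) if \(u=0\), provided that \(\gamma\ne0\) and, in the case \(u=0\), that the series for \(\varphi(x)\) and those in \(Z(1,0),\dots,Z(n,0)\) and \(Z(n,s)\) converge. In the case \(u=0\), if \(\varphi\) converges at some real \(\rho\) with \(|\rho|>|x|\), then the series for \(\varphi(x)\) converges and all the series in the definition of the \(Z(m,q)\) converge absolutely. -/

import Mathlib

namespace BellBinomial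

open Polynomial

/-- A sequence of real polynomials of binomial type with `f 0 = 1`. -/
structure IsBinomialType (f : ℕ → ℝ[X]) : Prop where
  zero : f 0 = 1
  eval_add : ∀ (n : ℕ) (x y : ℝ), (f n).eval (x + y) =
    ∑ k ∈ Finset.range (n + 1), (n.choose k : ℝ) * (f k).eval x * (f (n - k)).eval y

/-- The polynomial `f_n(x; a) = x / (a n + x) * f_n (a n + x)`, with `f_0(x; a) = 1`. For `n ≥ 1`
the polynomial `f_n` is divisible by `x`, and the quotient `f_n / x` is `(f n).divX`; see
`eval_shifted` for the quotient form. -/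
noncomputable def shifted (f : ℕ → ℝ[X]) (a : ℝ) (n : ℕ) : ℝ[X] :=
  if n = 0 then 1 else X * (f n).divX.comp (X + C (a * n))

theorem IsBinomialType.eval_zero {f : ℕ → ℝ[X]} (hf : IsBinomialType f) :
    ∀ n : ℕ, n ≠ 0 → (f n).eval 0 = 0 := by
  intro n
  induction n using Nat.strong_induction_on with
  | _ n ih =>
    intro hn
    obtain ⟨m, rfl⟩ := Nat.exists_eq_succ_of_ne_zero hn
    have h := hf.eval_add (m + 1) 0 0
    rw [Finset.sum_range_succ, Finset.sum_range_succ', Finset.sum_eq_zero] at h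
    · simpa [hf.zero] using h
    · intro k hk
      have hk' := Finset.mem_range.1 hk
      rw [ih (k + 1) (by omega) (by omega)]
      simp

theorem eval_shifted {f : ℕ → ℝ[X]} (hf : IsBinomialType f) (a x : ℝ) (n : ℕ)
    (h : a * n + x ≠ 0) :
    (shifted f a n).eval x = x / (a * n + x) * (f n).eval (a * n + x) := by
  by_cases hn : n = 0
  · subst hn
    have hx : x ≠ 0 := by simpa using h
    simp [shifted, hf.zero, hx]
  · have h0 : (f n).coeff 0 = 0 := by
      rw [coeff_zero_eq_eval_zero]; exact hf.eval_zero n hn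
    have h1 : (f n).eval (a * n + x) = (f n).divX.eval (a * n + x) * (a * n + x) := by
      conv_lhs => rw [← divX_mul_X_add (f n), h0]
      simp
    rw [h1]
    simp only [shifted, hn, if_false, eval_mul, eval_X, eval_comp, eval_add, eval_C]
    rw [add_comm x (a * n)]
    field_simp

/-- Coefficients of the series `∑_{m ≥ 1} c_m t^m / m!`; the value `c 0` plays no role. -/
noncomputable def egfCoeff (c : ℕ → ℝ) (m : ℕ) : ℝ :=
  if m = 0 then 0 else c m / (m.factorial : ℝ)

/-- The partial Bell polynomial `B_{n,k}(c_1, c_2, …)`, that is, `n!` times the coefficient of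
`t^n` in `(∑_{m ≥ 1} c_m t^m / m!)^k / k!`. -/
noncomputable def partialBell (c : ℕ → ℝ) (n k : ℕ) : ℝ :=
  (n.factorial : ℝ) / (k.factorial : ℝ) *
    PowerSeries.coeff n ((PowerSeries.mk (egfCoeff c)) ^ k)

/-- `B_{n,k} = 0` for `n < k`, so a series over `j ≥ R` of multiples of `B_{j,R}` may be written
as a series over all `j`. -/
theorem partialBell_eq_zero (c : ℕ → ℝ) {n k : ℕ} (h : n < k) : partialBell c n k = 0 := by
  have hX : (PowerSeries.X : PowerSeries ℝ) ∣ PowerSeries.mk (egfCoeff c) := by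
    rw [PowerSeries.X_dvd_iff]
    simp [egfCoeff]
  have h2 := (PowerSeries.X_pow_dvd_iff.1 (pow_dvd_pow_of_dvd hX k)) n h
  rw [partialBell, h2, mul_zero]

/-- The complete Bell polynomial `A_n(c_1, c_2, …)`, with `A_0 = 1`. -/
noncomputable def completeBell (c : ℕ → ℝ) (n : ℕ) : ℝ :=
  if n = 0 then 1 else ∑ k ∈ Finset.Icc 1 n, partialBell c n k

/-- Convergence of a series of reals in the usual sense: its partial sums
`t 0 + ⋯ + t (N - 1)` have a limit. -/
def Converges (t : ℕ → ℝ) : Prop :=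
  Summable t (SummationFilter.conditional ℕ)

/-- The sum of a convergent series of reals, the limit of its partial sums. -/
noncomputable def seriesSum (t : ℕ → ℝ) : ℝ :=
  ∑'[SummationFilter.conditional ℕ] j, t j

theorem tendsto_seriesSum {t : ℕ → ℝ} (h : Converges t) :
    Filter.Tendsto (fun N => ∑ j ∈ Finset.range N, t j) Filter.atTop (nhds (seriesSum t)) := by
  have h1 : HasSum t (seriesSum t) (SummationFilter.conditional ℕ) := Summable.hasSum h
  simpa [HasSum, Function.comp_def] using h1

/-- The terms of the series `φ(y) = ∑_{i ≥ 1} c_i y^i / i!`. -/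
noncomputable def phiTerm (c : ℕ → ℝ) (y : ℝ) (i : ℕ) : ℝ :=
  egfCoeff c i * y ^ i

noncomputable def phi (c : ℕ → ℝ) (y : ℝ) : ℝ :=
  seriesSum (phiTerm c y)

/-- The `j`-th term, with `R = n r + s`, of the series defining `Z(n, s)` for `α ≠ 0`:
`B_{j,R}(c) * D_{z=0}^{j u + v R} (e^{α z} f_n(β j + lam R + z; a)) * x^j / j!`.
It is zero for `j < R`. -/
noncomputable def expTerm (f : ℕ → ℝ[X]) (c : ℕ → ℝ) (r u v : ℕ) (x a α β lam : ℝ)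
    (n s j : ℕ) : ℝ :=
  let R : ℕ := n * r + s
  partialBell c j R *
    iteratedDeriv (j * u + v * R)
      (fun z : ℝ => Real.exp (α * z) * (shifted f a n).eval (β * j + lam * R + z)) 0 *
    (x ^ j / (j.factorial : ℝ))

/-- `γ = α^v φ(x α^u)`. -/
noncomputable def expGamma (c : ℕ → ℝ) (u v : ℕ) (x α : ℝ) : ℝ :=
  α ^ v * phi c (x * α ^ u)

/-- `Z(n, s)` for `α ≠ 0`. -/
noncomputable def expZ (f : ℕ → ℝ[X]) (c : ℕ → ℝ) (r u v : ℕ) (x a α β lam : ℝ)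
    (n s : ℕ) : ℝ :=
  let R : ℕ := n * r + s
  (R.factorial : ℝ) / (expGamma c u v x α ^ s * R) *
    seriesSum (expTerm f c r u v x a α β lam n s)

/-- The `j`-th term, with `R = n r + s`, of the sum defining `Z(n, s)` for `α = 0`:
`B_{j,R}(c) * (D_{z = β j + lam R}^{j u + v R} f_{n + (u+v) R}(z; a)) / (n + (u+v) R)! * x^j / j!`.
It is zero for `j < R`. -/
noncomputable def polyTerm (f : ℕ → ℝ[X]) (c : ℕ → ℝ) (r u v : ℕ) (x a β lam : ℝ)
    (n s j : ℕ) : ℝ :=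
  let R : ℕ := n * r + s
  partialBell c j R *
    (iteratedDeriv (j * u + v * R)
      (fun z : ℝ => (shifted f a (n + (u + v) * R)).eval z) (β * j + lam * R) /
      ((n + (u + v) * R).factorial : ℝ)) *
    (x ^ j / (j.factorial : ℝ))

/-- `γ` for `α = 0`: it is `c_1 x f_1'(0)^{u+v}` if `u ≥ 1`, and `f_1'(0)^v φ(x)` if `u = 0`. -/
noncomputable def polyGamma (f : ℕ → ℝ[X]) (c : ℕ → ℝ) (u v : ℕ) (x : ℝ) : ℝ :=
  if 1 ≤ u then c 1 * x * (derivative (f 1)).eval 0 ^ (u + v)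
  else (derivative (f 1)).eval 0 ^ v * phi c x

/-- `Z(n, s)` for `α = 0`. The sum runs over `R ≤ j ≤ ⌊n / u⌋ + R` if `u ≥ 1`, and over all
`j ≥ R` if `u = 0`. -/
noncomputable def polyZ (f : ℕ → ℝ[X]) (c : ℕ → ℝ) (r u v : ℕ) (x a β lam : ℝ)
    (n s : ℕ) : ℝ :=
  let R : ℕ := n * r + s
  (n.factorial : ℝ) * (R.factorial : ℝ) / (polyGamma f c u v x ^ s * R) *
    (if 1 ≤ u then ∑ j ∈ Finset.Icc R (n / u + R), polyTerm f c r u v x a β lam n s j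
     else seriesSum (polyTerm f c r u v x a β lam n s))

end BellBinomial

/-!
Write `q_n = f_n(·; a)`. Everything rests on one closure property: if `f` is of binomial type, so
is `f_n(x; a)` (`IsBinomialType.shifted`). Indeed `E_x(t) = ∑ f_n(x) t^n / n!` satisfies
`E_{x+y} = E_x E_y`, and by Lagrange inversion `∑ f_n(x; a) t^n / n!` arises from `E_x` by the
substitution inverse to `t / E_a`, which is multiplicative. Here the substitution is replaced by
the explicit transform `lagrange`, whose multiplicativity is proved directly. The exponential
formula (`IsBinomialType.completeBell_eq`) says that `A_n(x f_1'(0), x f_2'(0), …) = f_n(x)` for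
every sequence of binomial type.

Apply both facts to the sequence `n! [t^n] (H(t) / γ)^y`, where `H` is a power series with constant
coefficient `γ ≠ 0`, shifted by `r`: with `R = m r + q` and `Z(m, q) = m! / (γ^q R) [t^m] H^R` one
gets `A_n(s Z(1, 0), …, s Z(n, 0)) = s Z(n, s)` (`completeBell_coeff_pow`).

It remains to see that the `Z(m, q)` of the theorem have this form. Let `exp (x G)` be the
exponential generating series of `q_n(x)`. The derivative `D^N {e^{α z} q_m(y + z)}` at `z = 0` is
`m! [t^m] (α + G)^N e^{y G}` (`IsBinomialType.iteratedDeriv_exp_mul_eval`). Hence, summing over `j`,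
the series in `Z(m, q)` is `[t^m] H^R`, up to factorials, with
`H = V φ(U)`, `U = x (α + G)^u e^{β G}`, `V = (α + G)^v e^{lam G}`.
For `α = 0` the series `V φ(U)` is divisible by `t^{u+v}`, and `H` is the quotient. The constant
coefficient of `U` need not vanish, so `φ(U) = ∑ φ_j U^j` is defined by absolute convergence in
each coefficient (`CompSummable`); this is available when `φ` converges beyond `|U(0)|`. If `φ`
converges only at `U(0)` itself, `x` is replaced by `θ x` with `0 < θ < 1`, all series become power
series in `θ`, and Abel's limit theorem gives the result for `θ → 1`
(`completeBell_comp_of_converges`).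
-/

/-! ### Sequences of binomial type and their generating series -/

namespace BellBinomial

open Polynomial

/-- The exponential generating series `∑ f_n(x) t^n / n!`. -/
noncomputable def egf (f : ℕ → ℝ[X]) (x : ℝ) : PowerSeries ℝ :=
  PowerSeries.mk fun n => (f n).eval x / n.factorial

/-- The series `G = ∑ f_n'(0) t^n / n!`, for which `egf f x = exp (x G)` when `f` is of binomial
type. -/
noncomputable def exponent (f : ℕ → ℝ[X]) : PowerSeries ℝ :=
  PowerSeries.mk fun n => (f n).coeff 1 / n.factorial

theorem choose_mul_eq (n k : ℕ) (h : k ≤ n) (a b : ℝ) :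
    (n.choose k : ℝ) * a * b = n.factorial * (a / k.factorial * (b / (n - k).factorial)) := by
  rw [Nat.cast_choose ℝ h]
  have := Nat.factorial_ne_zero k
  have := Nat.factorial_ne_zero (n - k)
  field_simp

/-- Binomial convolution of sequences is multiplication of exponential generating series. -/
theorem sum_choose_eq_coeff (n : ℕ) (a b : ℕ → ℝ) :
    ∑ k ∈ Finset.range (n + 1), (n.choose k : ℝ) * a k * b (n - k) =
      n.factorial * PowerSeries.coeff n (PowerSeries.mk (fun k => a k / k.factorial) *
        PowerSeries.mk (fun k => b k / k.factorial)) := by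
  rw [PowerSeries.coeff_mul, Finset.Nat.sum_antidiagonal_eq_sum_range_succ_mk, Finset.mul_sum]
  refine Finset.sum_congr rfl fun k hk => ?_
  rw [choose_mul_eq n k (by simpa [Nat.lt_succ_iff] using hk)]
  simp

theorem isBinomialType_iff {f : ℕ → ℝ[X]} :
    IsBinomialType f ↔ f 0 = 1 ∧ ∀ x y, egf f (x + y) = egf f x * egf f y := by
  have key : ∀ x y n, (PowerSeries.coeff n (egf f (x + y)) =
      PowerSeries.coeff n (egf f x * egf f y)) ↔ (f n).eval (x + y) =
        ∑ k ∈ Finset.range (n + 1), (n.choose k : ℝ) * (f k).eval x * (f (n - k)).eval y := by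
    intro x y n
    have hn : (n.factorial : ℝ) ≠ 0 := by positivity
    rw [sum_choose_eq_coeff n (fun k => (f k).eval x) (fun k => (f k).eval y)]
    rw [egf, PowerSeries.coeff_mk, div_eq_iff hn, mul_comm (n.factorial : ℝ)]
    rfl
  constructor
  · intro h
    refine ⟨h.zero, fun x y => ?_⟩
    ext n
    exact (key x y n).2 (h.eval_add n x y)
  · rintro ⟨h0, h⟩
    exact ⟨h0, fun n x y => (key x y n).1 (by rw [h])⟩

namespace IsBinomialType

variable {f : ℕ → ℝ[X]} (hf : IsBinomialType f)

include hf

theorem egf_add (x y : ℝ) : egf f (x + y) = egf f x * egf f y :=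
  (isBinomialType_iff.1 hf).2 x y

theorem egf_zero : egf f 0 = 1 := by
  ext n
  rcases eq_or_ne n 0 with rfl | hn
  · simp [egf, hf.zero]
  · simp [egf, hf.eval_zero n hn, PowerSeries.coeff_one, hn]

theorem egf_nat_mul (k : ℕ) (x : ℝ) : egf f (k * x) = egf f x ^ k := by
  induction k with
  | zero => simp [hf.egf_zero]
  | succ k ih => rw [Nat.cast_succ, add_mul, one_mul, hf.egf_add, ih, pow_succ]

theorem constantCoeff_egf (x : ℝ) : PowerSeries.constantCoeff (egf f x) = 1 := by
  simp [egf, ← PowerSeries.coeff_zero_eq_constantCoeff_apply, hf.zero]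

theorem constantCoeff_exponent : PowerSeries.constantCoeff (exponent f) = 0 := by
  simp [exponent, ← PowerSeries.coeff_zero_eq_constantCoeff_apply, hf.zero, coeff_one]

theorem derivative_eq (n : ℕ) : derivative (f n) =
    ∑ k ∈ Finset.range (n + 1), C ((n.choose k : ℝ) * (f (n - k)).coeff 1) * f k := by
  refine Polynomial.funext fun x => ?_
  have h1 : HasDerivAt (fun y : ℝ => (f n).eval (x + y)) ((derivative (f n)).eval (x + 0)) 0 :=
    HasDerivAt.comp_const_add x 0 ((f n).hasDerivAt (x + 0))
  have h2 : HasDerivAt (fun y : ℝ => (f n).eval (x + y))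
      (∑ k ∈ Finset.range (n + 1), (n.choose k : ℝ) * (f k).eval x *
        (derivative (f (n - k))).eval 0) 0 := by
    simp_rw [hf.eval_add n x]
    exact HasDerivAt.fun_sum fun k _ => ((f (n - k)).hasDerivAt 0).const_mul _
  have h3 := h1.unique h2
  rw [add_zero] at h3
  rw [h3, eval_finsetSum]
  refine Finset.sum_congr rfl fun k _ => ?_
  rw [eval_mul, eval_C, ← coeff_zero_eq_eval_zero, coeff_derivative]
  simp only [zero_add, Nat.cast_zero, mul_one]
  ring

/-- `egf f x` satisfies `∂_x (egf f x) = G * egf f x`. -/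
theorem coeff_exponent_mul_egf (n : ℕ) (x : ℝ) :
    PowerSeries.coeff n (exponent f * egf f x) = (derivative (f n)).eval x / n.factorial := by
  have hn : (n.factorial : ℝ) ≠ 0 := by positivity
  rw [eq_div_iff hn, hf.derivative_eq, eval_finsetSum, mul_comm, mul_comm (exponent f)]
  refine (sum_choose_eq_coeff n (fun k => (f k).eval x) (fun k => (f k).coeff 1)).symm.trans ?_
  refine Finset.sum_congr rfl fun k _ => ?_
  rw [eval_mul, eval_C]
  ring

/-- Comparison of the coefficients of `x^k` in `egf f x = exp (x G)`. -/
theorem coeff_eq (n k : ℕ) :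
    (f n).coeff k = n.factorial / k.factorial * PowerSeries.coeff n (exponent f ^ k) := by
  have hfac : ∀ m : ℕ, (m.factorial : ℝ) ≠ 0 := fun m => by positivity
  induction k generalizing n with
  | zero =>
    rcases eq_or_ne n 0 with rfl | hn
    · simp [hf.zero]
    · simp [coeff_zero_eq_eval_zero, hf.eval_zero n hn, PowerSeries.coeff_one, hn]
  | succ k ih =>
    have h1 : (f n).coeff (k + 1) * (k + 1) = ∑ i ∈ Finset.range (n + 1),
        (n.choose i : ℝ) * (f i).coeff k * (f (n - i)).coeff 1 := by
      rw [← coeff_derivative, hf.derivative_eq, finsetSum_coeff]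
      refine Finset.sum_congr rfl fun i _ => ?_
      rw [coeff_C_mul]
      ring
    have h2 : PowerSeries.mk (fun i => (f i).coeff k / i.factorial) =
        PowerSeries.C (k.factorial : ℝ)⁻¹ * exponent f ^ k := by
      ext i
      rw [PowerSeries.coeff_mk, PowerSeries.coeff_C_mul, ih]
      have := hfac i
      field_simp
    rw [sum_choose_eq_coeff n (fun i => (f i).coeff k) (fun i => (f i).coeff 1), h2, mul_assoc,
      PowerSeries.coeff_C_mul] at h1
    have h3 : PowerSeries.coeff n (exponent f ^ k * PowerSeries.mk
        (fun i => (f i).coeff 1 / (i.factorial : ℝ))) =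
        PowerSeries.coeff n (exponent f ^ (k + 1)) := by
      rw [pow_succ]; rfl
    rw [h3] at h1
    have hk : (k : ℝ) + 1 ≠ 0 := by positivity
    rw [eq_comm, ← mul_left_inj' hk, h1, Nat.factorial_succ]
    push_cast
    have := hfac k
    field_simp

theorem natDegree_le (n : ℕ) : (f n).natDegree ≤ n := by
  rw [natDegree_le_iff_coeff_eq_zero]
  intro k hk
  rw [hf.coeff_eq, PowerSeries.coeff_of_lt_order, mul_zero]
  refine lt_of_lt_of_le (by exact_mod_cast hk : (n : ℕ∞) < k) ?_
  exact PowerSeries.le_order_pow_of_constantCoeff_eq_zero k hf.constantCoeff_exponent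

theorem eval_eq_sum (n : ℕ) (x : ℝ) : (f n).eval x =
    ∑ k ∈ Finset.range (n + 1), n.factorial / k.factorial *
      PowerSeries.coeff n (exponent f ^ k) * x ^ k := by
  rw [eval_eq_sum_range' (Nat.lt_succ_of_le (hf.natDegree_le n))]
  exact Finset.sum_congr rfl fun k _ => by rw [hf.coeff_eq]

/-- The exponential formula: `f_n(x) = A_n(x f_1'(0), x f_2'(0), …)`. -/
theorem completeBell_eq (n : ℕ) (x : ℝ) :
    completeBell (fun m => x * (f m).coeff 1) n = (f n).eval x := by
  rcases eq_or_ne n 0 with rfl | hn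
  · simp [completeBell, hf.zero]
  have hmk : PowerSeries.mk (egfCoeff fun m => x * (f m).coeff 1) =
      PowerSeries.C x * exponent f := by
    ext i
    rcases eq_or_ne i 0 with rfl | hi
    · simp [egfCoeff, hf.constantCoeff_exponent]
    · rw [PowerSeries.coeff_mk, PowerSeries.coeff_C_mul, egfCoeff, if_neg hi, exponent,
        PowerSeries.coeff_mk, mul_div_assoc]
  rw [completeBell, if_neg hn, hf.eval_eq_sum, Finset.range_eq_Ico,
    Finset.sum_eq_sum_Ico_succ_bot (Nat.succ_pos n)]
  simp only [pow_zero, PowerSeries.coeff_one, hn, if_false, mul_zero, zero_mul, zero_add]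
  refine Finset.sum_congr (by ext; simp) fun k _ => ?_
  rw [partialBell, hmk, mul_pow, ← map_pow, PowerSeries.coeff_C_mul]
  ring

theorem hasDerivAt_coeff_mul_egf (P : PowerSeries ℝ) (m : ℕ) (y z : ℝ) :
    HasDerivAt (fun z => PowerSeries.coeff m (P * egf f (y + z)))
      (PowerSeries.coeff m (exponent f * P * egf f (y + z))) z := by
  have : exponent f * P * egf f (y + z) = P * (exponent f * egf f (y + z)) := by ring
  rw [this]
  simp only [PowerSeries.coeff_mul m P]
  refine HasDerivAt.fun_sum fun p _ => HasDerivAt.const_mul _ ?_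
  rw [hf.coeff_exponent_mul_egf]
  simp only [egf, PowerSeries.coeff_mk]
  exact (HasDerivAt.comp_const_add y z ((f p.2).hasDerivAt (y + z))).div_const _

theorem iteratedDeriv_exp_mul_coeff (α y : ℝ) (m N : ℕ) (P : PowerSeries ℝ) :
    iteratedDeriv N (fun z => Real.exp (α * z) * PowerSeries.coeff m (P * egf f (y + z))) =
      fun z => Real.exp (α * z) * PowerSeries.coeff m
        ((PowerSeries.C α + exponent f) ^ N * P * egf f (y + z)) := by
  induction N generalizing P with
  | zero => simp
  | succ N ih =>
    have h : deriv (fun z => Real.exp (α * z) * PowerSeries.coeff m (P * egf f (y + z))) =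
        fun z => Real.exp (α * z) * PowerSeries.coeff m
          ((PowerSeries.C α + exponent f) * P * egf f (y + z)) := by
      funext z
      have h1 : HasDerivAt (fun z : ℝ => Real.exp (α * z)) (Real.exp (α * z) * (α * 1)) z :=
        ((hasDerivAt_id z).const_mul α).exp
      refine ((h1.mul (hf.hasDerivAt_coeff_mul_egf P m y z)).deriv).trans ?_
      rw [add_mul, add_mul, map_add, mul_assoc (PowerSeries.C α), PowerSeries.coeff_C_mul]
      ring
    rw [iteratedDeriv_succ', h, ih]
    funext z
    rw [pow_succ, mul_assoc _ _ P]

/-- The derivatives in the series of the theorem are coefficients of formal power series. -/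
theorem iteratedDeriv_exp_mul_eval (α y : ℝ) (m N : ℕ) (z : ℝ) :
    iteratedDeriv N (fun z => Real.exp (α * z) * (f m).eval (y + z)) z =
      Real.exp (α * z) * (m.factorial * PowerSeries.coeff m
        ((PowerSeries.C α + exponent f) ^ N * egf f (y + z))) := by
  have h := congrFun (hf.iteratedDeriv_exp_mul_coeff α y m N (PowerSeries.C (m.factorial : ℝ))) z
  have hm : (m.factorial : ℝ) ≠ 0 := by positivity
  have h1 : ∀ x, (f m).eval x =
      PowerSeries.coeff m (PowerSeries.C (m.factorial : ℝ) * egf f x) := by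
    intro x
    rw [PowerSeries.coeff_C_mul, egf, PowerSeries.coeff_mk]
    field_simp
  simp_rw [h1]
  rw [h, mul_right_comm, mul_comm _ (PowerSeries.C (m.factorial : ℝ)), PowerSeries.coeff_C_mul]

end IsBinomialType

end BellBinomial

/-! ### Lagrange inversion -/

namespace BellBinomial

open Polynomial

/-- The Lagrange transform of `h` with respect to `φ`, with coefficients
`[t^k] h (1 - t φ' / φ) φ^k`. By Lagrange inversion it is the composition of `h` with the
compositional inverse of `t / φ`, provided that `φ(0) ≠ 0`. -/
noncomputable def lagrange (φ h : PowerSeries ℝ) : PowerSeries ℝ :=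
  PowerSeries.mk fun k => PowerSeries.coeff k
    (h * ((1 - PowerSeries.X * PowerSeries.derivative ℝ φ * φ⁻¹) * φ ^ k))

theorem lagrange_add (φ g h : PowerSeries ℝ) :
    lagrange φ (g + h) = lagrange φ g + lagrange φ h := by
  ext k
  simp only [lagrange, PowerSeries.coeff_mk, map_add, add_mul]

theorem lagrange_C_mul (φ h : PowerSeries ℝ) (c : ℝ) :
    lagrange φ (PowerSeries.C c * h) = PowerSeries.C c * lagrange φ h := by
  ext k
  simp only [lagrange, PowerSeries.coeff_mk, PowerSeries.coeff_C_mul, mul_assoc]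

theorem lagrange_one {φ : PowerSeries ℝ} (hφ : PowerSeries.constantCoeff φ ≠ 0) :
    lagrange φ 1 = 1 := by
  ext k
  rw [lagrange, PowerSeries.coeff_mk, one_mul]
  cases k with
  | zero => simp
  | succ k =>
    have h1 : (1 - PowerSeries.X * PowerSeries.derivative ℝ φ * φ⁻¹) * φ ^ (k + 1) =
        φ ^ (k + 1) - PowerSeries.X * (φ ^ k * PowerSeries.derivative ℝ φ) := by
      have := PowerSeries.mul_inv_cancel φ hφ
      linear_combination (-PowerSeries.X * PowerSeries.derivative ℝ φ * φ ^ k) * this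
    have h2 := PowerSeries.coeff_derivative (φ ^ (k + 1)) k
    rw [PowerSeries.derivative_pow, Nat.add_sub_cancel, mul_assoc, ← map_natCast PowerSeries.C,
      PowerSeries.coeff_C_mul, Nat.cast_succ, mul_comm] at h2
    rw [h1, map_sub, PowerSeries.coeff_succ_X_mul,
      mul_right_cancel₀ (by positivity : (k : ℝ) + 1 ≠ 0) h2, sub_self, PowerSeries.coeff_one,
      if_neg (Nat.succ_ne_zero k)]

theorem lagrange_X_mul_inv_mul {φ : PowerSeries ℝ} (hφ : PowerSeries.constantCoeff φ ≠ 0)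
    (h : PowerSeries ℝ) : lagrange φ (PowerSeries.X * φ⁻¹ * h) = PowerSeries.X * lagrange φ h := by
  ext k
  cases k with
  | zero => simp [lagrange]
  | succ k =>
    have h1 : PowerSeries.X * φ⁻¹ * h *
        ((1 - PowerSeries.X * PowerSeries.derivative ℝ φ * φ⁻¹) * φ ^ (k + 1)) = PowerSeries.X *
          (h * ((1 - PowerSeries.X * PowerSeries.derivative ℝ φ * φ⁻¹) * φ ^ k)) := by
      have := PowerSeries.mul_inv_cancel φ hφ
      linear_combination (PowerSeries.X * h *
        (1 - PowerSeries.X * PowerSeries.derivative ℝ φ * φ⁻¹) * φ ^ k) * this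
    rw [PowerSeries.coeff_succ_X_mul, lagrange, PowerSeries.coeff_mk, h1,
      PowerSeries.coeff_succ_X_mul, lagrange, PowerSeries.coeff_mk]

theorem lagrange_mul {φ : PowerSeries ℝ} (hφ : PowerSeries.constantCoeff φ ≠ 0)
    (g h : PowerSeries ℝ) : lagrange φ (g * h) = lagrange φ g * lagrange φ h := by
  ext n
  induction n using Nat.strong_induction_on generalizing h with
  | _ n ih =>
    -- split off the constant term: `h = c + (t / φ) h₁`
    obtain ⟨h', hh'⟩ := PowerSeries.X_dvd_iff.2
      (show PowerSeries.constantCoeff (h - PowerSeries.C (PowerSeries.constantCoeff h)) = 0 by simp)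
    set c := PowerSeries.constantCoeff h
    have hh : h = PowerSeries.C c * 1 + PowerSeries.X * φ⁻¹ * (φ * h') := by
      have := PowerSeries.mul_inv_cancel φ hφ
      linear_combination hh' - PowerSeries.X * h' * this
    have h1 : g * h = PowerSeries.C c * g + PowerSeries.X * φ⁻¹ * (g * (φ * h')) := by
      conv_lhs => rw [hh]
      ring
    have h2 : lagrange φ h = PowerSeries.C c + PowerSeries.X * lagrange φ (φ * h') := by
      conv_lhs => rw [hh]
      rw [lagrange_add, lagrange_X_mul_inv_mul hφ, lagrange_C_mul, lagrange_one hφ, mul_one]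
    rw [h1, h2, lagrange_add, lagrange_C_mul, lagrange_X_mul_inv_mul hφ, mul_add,
      mul_comm (lagrange φ g) (PowerSeries.C c), map_add, map_add]
    congr 1
    rw [mul_left_comm (lagrange φ g)]
    cases n with
    | zero => simp
    | succ n =>
      rw [PowerSeries.coeff_succ_X_mul, PowerSeries.coeff_succ_X_mul, ih n (Nat.lt_succ_self n)]

namespace IsBinomialType

variable {f : ℕ → ℝ[X]} (hf : IsBinomialType f)

include hf

theorem egf_inv (x : ℝ) : (egf f x)⁻¹ = egf f (-x) := by
  rw [PowerSeries.inv_eq_iff_mul_eq_one (by simp [hf.constantCoeff_egf]), ← hf.egf_add,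
    neg_add_cancel, hf.egf_zero]

/-- The logarithmic derivative of `egf f x = exp (x G)` is linear in `x`. It is additive because
`egf f` is multiplicative, and its coefficients are continuous in `x`. -/
theorem logDeriv_smul (c x : ℝ) :
    PowerSeries.derivative ℝ (egf f (c * x)) * egf f (-(c * x)) =
      PowerSeries.C c * (PowerSeries.derivative ℝ (egf f x) * egf f (-x)) := by
  ext n
  let L : ℝ →+ ℝ := AddMonoidHom.mk'
    (fun x => PowerSeries.coeff n (PowerSeries.derivative ℝ (egf f x) * egf f (-x))) (by
      intro a b
      have ha : egf f a * egf f (-a) = 1 := by rw [← hf.egf_add, add_neg_cancel, hf.egf_zero]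
      have hb : egf f b * egf f (-b) = 1 := by rw [← hf.egf_add, add_neg_cancel, hf.egf_zero]
      rw [neg_add, hf.egf_add, hf.egf_add, Derivation.leibniz, smul_eq_mul, smul_eq_mul, ← map_add]
      congr 1
      linear_combination PowerSeries.derivative ℝ (egf f b) * egf f (-b) * ha +
        PowerSeries.derivative ℝ (egf f a) * egf f (-a) * hb)
  have hL : Continuous L := by
    change Continuous fun x => PowerSeries.coeff n
      (PowerSeries.derivative ℝ (egf f x) * egf f (-x))
    simp only [PowerSeries.coeff_mul, PowerSeries.coeff_derivative, egf, PowerSeries.coeff_mk]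
    fun_prop
  rw [PowerSeries.coeff_C_mul]
  exact map_real_smul L hL c x

theorem lagrange_egf (a x : ℝ) : lagrange (egf f a) (egf f x) = egf (shifted f a) x := by
  ext k
  have hk : (k.factorial : ℝ) ≠ 0 := by positivity
  set P := 1 - PowerSeries.X * PowerSeries.derivative ℝ (egf f a) * (egf f a)⁻¹ with hP
  have h1 : ∀ x, PowerSeries.coeff k (lagrange (egf f a) (egf f x)) =
      PowerSeries.coeff k (P * egf f (a * k + x)) := by
    intro x
    rw [lagrange, PowerSeries.coeff_mk, hf.egf_add, mul_comm a, hf.egf_nat_mul]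
    congr 1
    ring
  rw [h1]
  -- both sides are continuous in `x`, so the zero of the denominator `a k + x` can be avoided
  refine congrFun (Continuous.ext_on (dense_compl_singleton (-(a * k)))
    (f := fun x => PowerSeries.coeff k (P * egf f (a * k + x)))
    (g := fun x => PowerSeries.coeff k (egf (shifted f a) x)) ?_ ?_ ?_) x
  · exact continuous_iff_continuousAt.2
      fun z => (hf.hasDerivAt_coeff_mul_egf P k (a * k) z).continuousAt
  · simp only [egf, PowerSeries.coeff_mk]
    fun_prop
  · intro x hx
    have hy : a * k + x ≠ 0 := fun h => hx (by simp only [Set.mem_singleton_iff]; linarith)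
    set y := a * k + x with hydef
    have h2 : PowerSeries.derivative ℝ (egf f a) * egf f (-a) * egf f y =
        PowerSeries.C (a / y) * PowerSeries.derivative ℝ (egf f y) := by
      have h3 := hf.logDeriv_smul (a / y) y
      rw [div_mul_cancel₀ _ hy] at h3
      have h4 : egf f y * egf f (-y) = 1 := by rw [← hf.egf_add, add_neg_cancel, hf.egf_zero]
      rw [h3]
      linear_combination (PowerSeries.C (a / y) * PowerSeries.derivative ℝ (egf f y)) * h4
    have h5 : P * egf f y = egf f y -
        PowerSeries.C (a / y) * (PowerSeries.X * PowerSeries.derivative ℝ (egf f y)) := by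
      rw [hP, hf.egf_inv]
      linear_combination -PowerSeries.X * h2
    have h6 : PowerSeries.coeff k (PowerSeries.X * PowerSeries.derivative ℝ (egf f y)) =
        k * PowerSeries.coeff k (egf f y) := by
      cases k with
      | zero => simp
      | succ k =>
        rw [PowerSeries.coeff_succ_X_mul, PowerSeries.coeff_derivative, mul_comm]
        push_cast
        rfl
    change PowerSeries.coeff k (P * egf f y) = PowerSeries.coeff k (egf (shifted f a) x)
    rw [h5, map_sub, PowerSeries.coeff_C_mul, h6, egf, egf, PowerSeries.coeff_mk,
      PowerSeries.coeff_mk, eval_shifted hf a x k hy, ← hydef]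
    field_simp
    rw [hydef]
    ring

/-- The shifted sequence `f_n(x; a)` is again of binomial type. -/
theorem shifted (a : ℝ) : IsBinomialType (shifted f a) := by
  refine isBinomialType_iff.2 ⟨by simp [BellBinomial.shifted], fun x y => ?_⟩
  rw [← hf.lagrange_egf, ← hf.lagrange_egf, ← hf.lagrange_egf, hf.egf_add,
    lagrange_mul (by simp [hf.constantCoeff_egf])]

end IsBinomialType

end BellBinomial

/-! ### Powers of a power series and the complete Bell equation -/

namespace BellBinomial

open Polynomial

theorem coeff_pow_congr {c d : ℕ → ℝ} {n : ℕ} (h : ∀ m ∈ Finset.Icc 1 n, c m = d m) (k : ℕ) :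
    ∀ i ≤ n, PowerSeries.coeff i (PowerSeries.mk (egfCoeff c) ^ k) =
      PowerSeries.coeff i (PowerSeries.mk (egfCoeff d) ^ k) := by
  induction k with
  | zero => simp
  | succ k ih =>
    intro i hi
    rw [pow_succ, pow_succ, PowerSeries.coeff_mul, PowerSeries.coeff_mul]
    refine Finset.sum_congr rfl fun p hp => ?_
    have hp' := Finset.HasAntidiagonal.mem_antidiagonal.1 hp
    rw [ih p.1 (by omega), PowerSeries.coeff_mk, PowerSeries.coeff_mk, egfCoeff, egfCoeff]
    split_ifs with h0
    · rfl
    · rw [h p.2 (Finset.mem_Icc.2 ⟨by omega, by omega⟩)]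

theorem completeBell_congr {c d : ℕ → ℝ} {n : ℕ} (h : ∀ m ∈ Finset.Icc 1 n, c m = d m) :
    completeBell c n = completeBell d n := by
  simp only [completeBell, partialBell, coeff_pow_congr h _ n le_rfl]

theorem completeBell_pow_mul (b : ℝ) (c : ℕ → ℝ) (n : ℕ) :
    completeBell (fun m => b ^ m * c m) n = b ^ n * completeBell c n := by
  have h : PowerSeries.mk (egfCoeff fun m => b ^ m * c m) =
      PowerSeries.rescale b (PowerSeries.mk (egfCoeff c)) := by
    ext i
    rw [PowerSeries.coeff_rescale, PowerSeries.coeff_mk, PowerSeries.coeff_mk, egfCoeff, egfCoeff]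
    split_ifs
    · simp
    · ring
  simp only [completeBell, partialBell, h, ← map_pow, PowerSeries.coeff_rescale]
  split_ifs with hn
  · simp [hn]
  · rw [Finset.mul_sum]
    exact Finset.sum_congr rfl fun k _ => by ring

/-- The polynomials in `y` with values `n! [t^n] K(t)^y`, for a power series `K` with constant
coefficient `1`; they come from the binomial series of `(1 + (K - 1))^y`. -/
noncomputable def powSeq (K : PowerSeries ℝ) (n : ℕ) : ℝ[X] :=
  ∑ k ∈ Finset.range (n + 1),
    C ((n.factorial : ℝ) / k.factorial * PowerSeries.coeff n ((K - 1) ^ k)) * descPochhammer ℝ k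

theorem powSeq_eval_natCast {K : PowerSeries ℝ} (hK : PowerSeries.constantCoeff K = 1) (n N : ℕ) :
    (powSeq K n).eval (N : ℝ) = n.factorial * PowerSeries.coeff n (K ^ N) := by
  have h1 : (powSeq K n).eval (N : ℝ) = ∑ k ∈ Finset.range (n + 1),
      n.factorial * (PowerSeries.coeff n ((K - 1) ^ k) * (N.choose k : ℝ)) := by
    rw [powSeq, eval_finsetSum]
    refine Finset.sum_congr rfl fun k _ => ?_
    rw [eval_mul, eval_C, descPochhammer_eval_eq_descFactorial,
      Nat.descFactorial_eq_factorial_mul_choose]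
    have : (k.factorial : ℝ) ≠ 0 := by positivity
    push_cast
    field_simp
  have h2 : PowerSeries.coeff n (K ^ N) = ∑ k ∈ Finset.range (N + 1),
      PowerSeries.coeff n ((K - 1) ^ k) * (N.choose k : ℝ) := by
    conv_lhs => rw [← sub_add_cancel K 1, add_pow, map_sum]
    refine Finset.sum_congr rfl fun k _ => ?_
    rw [one_pow, mul_one, ← map_natCast PowerSeries.C, PowerSeries.coeff_mul_C]
  rw [h1, ← Finset.mul_sum, h2]
  congr 1
  trans ∑ k ∈ Finset.range (n + N + 1), PowerSeries.coeff n ((K - 1) ^ k) * (N.choose k : ℝ)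
  · refine Finset.sum_subset (Finset.range_mono (by omega)) fun k _ hk => ?_
    rw [PowerSeries.coeff_of_lt_order, zero_mul]
    have hk' : n < k := by simpa [Nat.lt_succ_iff] using hk
    refine lt_of_lt_of_le (by exact_mod_cast hk' : (n : ℕ∞) < k) ?_
    exact PowerSeries.le_order_pow_of_constantCoeff_eq_zero k (by simp [hK])
  · refine (Finset.sum_subset (Finset.range_mono (by omega)) fun k _ hk => ?_).symm
    rw [Nat.choose_eq_zero_of_lt (by simpa [Nat.lt_succ_iff] using hk), Nat.cast_zero, mul_zero]

theorem eq_of_eval_natCast {p q : ℝ[X]} (h : ∀ N : ℕ, p.eval (N : ℝ) = q.eval (N : ℝ)) :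
    p = q :=
  eq_of_infinite_eval_eq p q
    ((Set.infinite_range_of_injective Nat.cast_injective).mono (by rintro _ ⟨N, rfl⟩; exact h N))

theorem isBinomialType_powSeq {K : PowerSeries ℝ} (hK : PowerSeries.constantCoeff K = 1) :
    IsBinomialType (powSeq K) := by
  refine ⟨by simp [powSeq], fun n => ?_⟩
  have hnat : ∀ N M : ℕ, (powSeq K n).eval ((N : ℝ) + M) = ∑ k ∈ Finset.range (n + 1),
      (n.choose k : ℝ) * (powSeq K k).eval (N : ℝ) * (powSeq K (n - k)).eval (M : ℝ) := by
    intro N M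
    have hegf : ∀ N : ℕ, PowerSeries.mk (fun k => (powSeq K k).eval (N : ℝ) / k.factorial) =
        K ^ N := by
      intro N
      ext k
      have : (k.factorial : ℝ) ≠ 0 := by positivity
      rw [PowerSeries.coeff_mk, powSeq_eval_natCast hK]
      field_simp
    rw [sum_choose_eq_coeff n (fun k => (powSeq K k).eval (N : ℝ))
      (fun k => (powSeq K k).eval (M : ℝ)), hegf, hegf, ← pow_add, ← powSeq_eval_natCast hK]
    push_cast
    rfl
  -- a polynomial identity may be checked at natural numbers, one variable at a time
  have hx : ∀ (M : ℕ) (x : ℝ), (powSeq K n).eval (x + M) = ∑ k ∈ Finset.range (n + 1),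
      (n.choose k : ℝ) * (powSeq K k).eval x * (powSeq K (n - k)).eval (M : ℝ) := by
    intro M x
    have h := eq_of_eval_natCast (p := (powSeq K n).comp (X + C (M : ℝ)))
      (q := ∑ k ∈ Finset.range (n + 1), C (n.choose k : ℝ) * powSeq K k *
        C ((powSeq K (n - k)).eval (M : ℝ)))
      (fun N => by simpa [eval_finsetSum] using hnat N M)
    simpa [eval_finsetSum] using congrArg (eval x) h
  intro x y
  have h := eq_of_eval_natCast (p := (powSeq K n).comp (C x + X))
    (q := ∑ k ∈ Finset.range (n + 1), C (n.choose k : ℝ) * C ((powSeq K k).eval x) *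
      powSeq K (n - k)) (fun M => by simpa [eval_finsetSum] using hx M x)
  simpa [eval_finsetSum] using congrArg (eval y) h

theorem coeff_one_shifted {f : ℕ → ℝ[X]} (hf : IsBinomialType f) {a : ℝ} {m : ℕ} (hm : m ≠ 0)
    (ha : a ≠ 0) : (shifted f a m).coeff 1 = (f m).eval (a * m) / (a * m) := by
  have h0 : (f m).coeff 0 = 0 := by rw [coeff_zero_eq_eval_zero, hf.eval_zero m hm]
  have hne : a * m ≠ 0 := mul_ne_zero ha (by exact_mod_cast hm)
  rw [eq_div_iff hne]
  conv_rhs => rw [← divX_mul_X_add (f m), h0]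
  rw [shifted, if_neg hm, coeff_X_mul, coeff_zero_eq_eval_zero]
  simp

/-- The complete Bell equation for the coefficients of the powers of one power series: Lagrange
inversion for the sequence `n! [t^n] (H / γ)^y` of binomial type. -/
theorem completeBell_coeff_pow {H : PowerSeries ℝ} {γ : ℝ} (hγ : PowerSeries.constantCoeff H = γ)
    (hγ0 : γ ≠ 0) {n r s : ℕ} (hr : 1 ≤ r) (hR : 1 ≤ n * r + s) {w : ℕ → ℝ}
    (hw : ∀ m ∈ Finset.Icc 1 n, w m =
      m.factorial / ((m * r : ℕ) : ℝ) * PowerSeries.coeff m (H ^ (m * r))) :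
    completeBell (fun m => s * w m) n = s * (n.factorial / (γ ^ s * ((n * r + s : ℕ) : ℝ)) *
      PowerSeries.coeff n (H ^ (n * r + s))) := by
  set K := PowerSeries.C γ⁻¹ * H with hKdef
  have hK : PowerSeries.constantCoeff K = 1 := by simp [hKdef, hγ, hγ0]
  have hKpow : ∀ m N, PowerSeries.coeff m (K ^ N) = (γ ^ N)⁻¹ * PowerSeries.coeff m (H ^ N) := by
    intro m N
    rw [hKdef, mul_pow, ← map_pow, PowerSeries.coeff_C_mul, inv_pow]
  have hf := isBinomialType_powSeq hK
  have hr0 : (r : ℝ) ≠ 0 := by exact_mod_cast (by omega : r ≠ 0)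
  have hR0 : (r : ℝ) * n + s ≠ 0 := by
    have : ((n * r + s : ℕ) : ℝ) ≠ 0 := by exact_mod_cast (by omega : n * r + s ≠ 0)
    push_cast at this
    rwa [mul_comm]
  have h1 := (hf.shifted (r : ℝ)).completeBell_eq n (s : ℝ)
  have h2 : completeBell (fun m => s * w m) n = completeBell
      (fun m => (γ ^ r) ^ m * (s * (shifted (powSeq K) r m).coeff 1)) n := by
    refine completeBell_congr fun m hm => ?_
    have hm0 : m ≠ 0 := by have := (Finset.mem_Icc.1 hm).1; omega
    have hcast : (r : ℝ) * m = ((m * r : ℕ) : ℝ) := by push_cast; ring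
    rw [hw m hm, coeff_one_shifted hf hm0 hr0, hcast, powSeq_eval_natCast hK, hKpow, ← pow_mul,
      mul_comm r m]
    field_simp
  have hcast : (r : ℝ) * n + s = ((n * r + s : ℕ) : ℝ) := by push_cast; ring
  rw [h2, completeBell_pow_mul, h1, eval_shifted hf _ _ _ hR0, hcast, powSeq_eval_natCast hK,
    hKpow, ← pow_mul, mul_comm r n, pow_add]
  rw [hcast] at hR0
  field_simp

end BellBinomial

/-! ### Composition of power series and boundary convergence -/

namespace BellBinomial

open Filter Topology

/-- The series `∑ ψ_j U^j` of power series converges absolutely in each coefficient. This makes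
sense of `ψ(U)` also when `U` has a nonzero constant coefficient. -/
def CompSummable (ψ U : PowerSeries ℝ) : Prop :=
  ∀ n, Summable fun j => PowerSeries.coeff j ψ * PowerSeries.coeff n (U ^ j)

/-- The composition `ψ(U) = ∑ ψ_j U^j`, computed coefficientwise; it is meaningful under
`CompSummable ψ U`. -/
noncomputable def comp (ψ U : PowerSeries ℝ) : PowerSeries ℝ :=
  PowerSeries.mk fun n => ∑' j, PowerSeries.coeff j ψ * PowerSeries.coeff n (U ^ j)

theorem CompSummable.hasSum_mul_comp {ψ U : PowerSeries ℝ} (h : CompSummable ψ U)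
    (P : PowerSeries ℝ) (n : ℕ) :
    HasSum (fun j => PowerSeries.coeff j ψ * PowerSeries.coeff n (P * U ^ j))
      (PowerSeries.coeff n (P * comp ψ U)) := by
  simp only [PowerSeries.coeff_mul n P, Finset.mul_sum]
  refine hasSum_sum fun p _ => ?_
  have h1 := ((h p.2).hasSum).mul_left (PowerSeries.coeff p.1 P)
  rw [comp, PowerSeries.coeff_mk]
  exact h1.congr_fun fun j => by ring

/-- The Cauchy product: `(ψ χ)(U) = ψ(U) χ(U)`, with convergence of the series on the left. -/
theorem CompSummable.hasSum_mul {ψ χ U : PowerSeries ℝ} (hψ : CompSummable ψ U)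
    (hχ : CompSummable χ U) (n : ℕ) :
    HasSum (fun j => PowerSeries.coeff j (ψ * χ) * PowerSeries.coeff n (U ^ j))
      (PowerSeries.coeff n (comp ψ U * comp χ U)) := by
  have key : ∀ j, PowerSeries.coeff j (ψ * χ) * PowerSeries.coeff n (U ^ j) =
      ∑ p ∈ Finset.HasAntidiagonal.antidiagonal n, ∑ q ∈ Finset.HasAntidiagonal.antidiagonal j,
        (PowerSeries.coeff q.1 ψ * PowerSeries.coeff p.1 (U ^ q.1)) *
          (PowerSeries.coeff q.2 χ * PowerSeries.coeff p.2 (U ^ q.2)) := by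
    intro j
    rw [Finset.sum_comm, PowerSeries.coeff_mul, Finset.sum_mul]
    refine Finset.sum_congr rfl fun q hq => ?_
    rw [← Finset.HasAntidiagonal.mem_antidiagonal.1 hq, pow_add, PowerSeries.coeff_mul n,
      Finset.mul_sum]
    exact Finset.sum_congr rfl fun p _ => by ring
  simp only [key]
  rw [PowerSeries.coeff_mul]
  refine hasSum_sum fun p _ => ?_
  rw [comp, comp, PowerSeries.coeff_mk, PowerSeries.coeff_mk,
    tsum_mul_tsum_eq_tsum_sum_antidiagonal_of_summable_norm (hψ p.1).norm (hχ p.2).norm]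
  exact (summable_norm_sum_mul_antidiagonal_of_summable_norm
    (hψ p.1).norm (hχ p.2).norm).of_norm.hasSum

theorem CompSummable.mul {ψ χ U : PowerSeries ℝ} (hψ : CompSummable ψ U)
    (hχ : CompSummable χ U) : CompSummable (ψ * χ) U := fun n => (hψ.hasSum_mul hχ n).summable

theorem CompSummable.comp_mul {ψ χ U : PowerSeries ℝ} (hψ : CompSummable ψ U)
    (hχ : CompSummable χ U) : comp (ψ * χ) U = comp ψ U * comp χ U := by
  ext n
  rw [← (hψ.hasSum_mul hχ n).tsum_eq, comp, PowerSeries.coeff_mk]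

theorem hasSum_one_comp (U : PowerSeries ℝ) (n : ℕ) :
    HasSum (fun j => PowerSeries.coeff j (1 : PowerSeries ℝ) * PowerSeries.coeff n (U ^ j))
      (PowerSeries.coeff n (1 : PowerSeries ℝ)) := by
  convert hasSum_single (f := fun j => PowerSeries.coeff j (1 : PowerSeries ℝ) *
    PowerSeries.coeff n (U ^ j)) 0 ?_ using 1
  · simp
  · intro j hj
    simp [PowerSeries.coeff_one, hj]

theorem CompSummable.pow {ψ U : PowerSeries ℝ} (h : CompSummable ψ U) (R : ℕ) :
    CompSummable (ψ ^ R) U ∧ comp (ψ ^ R) U = comp ψ U ^ R := by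
  induction R with
  | zero =>
    rw [pow_zero, pow_zero]
    refine ⟨fun n => (hasSum_one_comp U n).summable, ?_⟩
    ext n
    rw [← (hasSum_one_comp U n).tsum_eq, comp, PowerSeries.coeff_mk]
  | succ R ih => exact ⟨ih.1.mul h, by rw [pow_succ, ih.1.comp_mul h, ih.2, pow_succ]⟩

theorem CompSummable.hasSum_mul_pow {ψ U : PowerSeries ℝ} (h : CompSummable ψ U)
    (P : PowerSeries ℝ) (R n : ℕ) :
    HasSum (fun j => PowerSeries.coeff j (ψ ^ R) * PowerSeries.coeff n (P * U ^ j))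
      (PowerSeries.coeff n (P * comp ψ U ^ R)) := by
  rw [← (h.pow R).2]
  exact (h.pow R).1.hasSum_mul_comp P n

theorem compSummable_of_constantCoeff_eq_zero (ψ : PowerSeries ℝ) {U : PowerSeries ℝ}
    (hU : PowerSeries.constantCoeff U = 0) : CompSummable ψ U := by
  intro n
  refine summable_of_ne_finset_zero (s := Finset.range (n + 1)) fun j hj => ?_
  have hj' : n < j := by simpa [Nat.lt_succ_iff] using hj
  have h0 : PowerSeries.coeff n (U ^ j) = 0 := PowerSeries.coeff_of_lt_order n
    (lt_of_lt_of_le (by exact_mod_cast hj' : (n : ℕ∞) < j)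
      (PowerSeries.le_order_pow_of_constantCoeff_eq_zero j hU))
  rw [h0, mul_zero]

/-- A weighted `ℓ¹` bound for the coefficients of the powers of a power series. -/
theorem abs_coeff_pow_mul_le {U : PowerSeries ℝ} {τ b : ℝ} (hτ : 0 ≤ τ) {N : ℕ}
    (hb : ∑ i ∈ Finset.range (N + 1), |PowerSeries.coeff i U| * τ ^ i ≤ b) (hb1 : 0 ≤ b) (j : ℕ) :
    ∀ n ≤ N, |PowerSeries.coeff n (U ^ j)| * τ ^ n ≤ b ^ j := by
  induction j with
  | zero =>
    intro n _
    rcases eq_or_ne n 0 with rfl | hn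
    · simp
    · simp [PowerSeries.coeff_one, hn]
  | succ j ih =>
    intro n hn
    rw [pow_succ', PowerSeries.coeff_mul]
    calc |∑ p ∈ Finset.HasAntidiagonal.antidiagonal n,
            PowerSeries.coeff p.1 U * PowerSeries.coeff p.2 (U ^ j)| * τ ^ n
        ≤ (∑ p ∈ Finset.HasAntidiagonal.antidiagonal n,
            |PowerSeries.coeff p.1 U * PowerSeries.coeff p.2 (U ^ j)|) * τ ^ n := by
          gcongr
          exact Finset.abs_sum_le_sum_abs _ _
      _ = ∑ p ∈ Finset.HasAntidiagonal.antidiagonal n, (|PowerSeries.coeff p.1 U| * τ ^ p.1) *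
            (|PowerSeries.coeff p.2 (U ^ j)| * τ ^ p.2) := by
          rw [Finset.sum_mul]
          refine Finset.sum_congr rfl fun p hp => ?_
          rw [← Finset.HasAntidiagonal.mem_antidiagonal.1 hp, pow_add, abs_mul]
          ring
      _ ≤ ∑ p ∈ Finset.HasAntidiagonal.antidiagonal n,
            (|PowerSeries.coeff p.1 U| * τ ^ p.1) * b ^ j := by
          refine Finset.sum_le_sum fun p hp => ?_
          have := Finset.HasAntidiagonal.mem_antidiagonal.1 hp
          exact mul_le_mul_of_nonneg_left (ih p.2 (by omega)) (by positivity)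
      _ ≤ b ^ (j + 1) := by
          rw [← Finset.sum_mul, pow_succ', Finset.Nat.sum_antidiagonal_eq_sum_range_succ_mk]
          refine mul_le_mul_of_nonneg_right (le_trans ?_ hb) (by positivity)
          exact Finset.sum_le_sum_of_subset_of_nonneg (Finset.range_mono (by omega))
            fun i _ _ => by positivity

/-- `ψ(U)` is defined if the coefficients `ψ_j` are `O(|ρ|^(-j))` for some `|ρ| > |U(0)|`. -/
theorem compSummable_of_bounded {ψ U : PowerSeries ℝ} {M ρ : ℝ}
    (hM : ∀ j, |PowerSeries.coeff j ψ * ρ ^ j| ≤ M)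
    (hU : |PowerSeries.constantCoeff U| < |ρ|) : CompSummable ψ U := by
  intro n
  obtain ⟨b, hb1, hb2⟩ := exists_between hU
  have hb0 : 0 ≤ b := (abs_nonneg _).trans hb1.le
  have hρ : 0 < |ρ| := lt_of_le_of_lt hb0 hb2
  -- at `τ = 0` the weighted `ℓ¹` norm is `|U_0| < b`
  obtain ⟨τ, hτ, hτb⟩ : ∃ τ : ℝ, 0 < τ ∧
      ∑ i ∈ Finset.range (n + 1), |PowerSeries.coeff i U| * τ ^ i ≤ b := by
    have hc : Continuous fun τ : ℝ =>
        ∑ i ∈ Finset.range (n + 1), |PowerSeries.coeff i U| * τ ^ i := by fun_prop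
    have h0 : ∑ i ∈ Finset.range (n + 1), |PowerSeries.coeff i U| * (0 : ℝ) ^ i < b := by
      rw [Finset.sum_range_succ']
      simpa using hb1
    have h1 : ∀ᶠ τ in 𝓝[>] (0 : ℝ),
        ∑ i ∈ Finset.range (n + 1), |PowerSeries.coeff i U| * τ ^ i < b :=
      (hc.tendsto 0).mono_left nhdsWithin_le_nhds |>.eventually (gt_mem_nhds h0)
    obtain ⟨τ, h2, h3⟩ := (h1.and self_mem_nhdsWithin).exists
    exact ⟨τ, h3, h2.le⟩
  have hgeo : Summable fun j : ℕ => M * (τ ^ n)⁻¹ * (b / |ρ|) ^ j :=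
    (summable_geometric_of_lt_one (by positivity) ((div_lt_one hρ).2 hb2)).mul_left _
  refine Summable.of_norm_bounded hgeo fun j => ?_
  have h1 := hM j
  have h2 := abs_coeff_pow_mul_le hτ.le hτb hb0 j n le_rfl
  have hM0 : 0 ≤ M := (abs_nonneg _).trans (hM 0)
  rw [abs_mul, abs_pow, ← le_div_iff₀ (by positivity)] at h1
  rw [← le_div_iff₀ (by positivity)] at h2
  rw [Real.norm_eq_abs, abs_mul]
  refine (mul_le_mul h1 h2 (abs_nonneg _) (by positivity)).trans (le_of_eq ?_)
  rw [div_pow]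
  field_simp

theorem Converges.of_summable {t : ℕ → ℝ} (h : Summable t) :
    Converges t ∧ seriesSum t = ∑' j, t j := by
  have h1 : HasSum t (∑' j, t j) (SummationFilter.conditional ℕ) :=
    h.hasSum.mono_left (SummationFilter.LeAtTop.le_atTop)
  exact ⟨h1.summable, h1.tsum_eq⟩

theorem Converges.mul_left {t : ℕ → ℝ} (h : Converges t) (b : ℝ) :
    Converges (fun j => b * t j) ∧ seriesSum (fun j => b * t j) = b * seriesSum t := by
  have h1 : HasSum (fun j => b * t j) (b * seriesSum t) (SummationFilter.conditional ℕ) :=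
    (Summable.hasSum h).mul_left b
  exact ⟨h1.summable, h1.tsum_eq⟩

theorem Converges.bounded {t : ℕ → ℝ} (h : Converges t) : ∃ M, ∀ j, |t j| ≤ M := by
  have h1 := tendsto_seriesSum h
  have h2 : Tendsto t atTop (𝓝 0) := by
    have h3 := (h1.comp (tendsto_add_atTop_nat 1)).sub h1
    simpa [Function.comp_def, Finset.sum_range_succ] using h3
  obtain ⟨M, hM⟩ := h2.abs.bddAbove_range
  exact ⟨M, fun j => hM ⟨j, rfl⟩⟩

/-- Abel's limit theorem for `seriesSum`. -/
theorem Converges.tendsto_abel {t : ℕ → ℝ} (h : Converges t) :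
    Tendsto (fun θ : ℝ => ∑' j, t j * θ ^ j) (𝓝[<] 1) (𝓝 (seriesSum t)) :=
  Real.tendsto_tsum_powerSeries_nhdsWithin_lt (tendsto_seriesSum h)

theorem compSummable_of_converges {ψ U : PowerSeries ℝ} {ρ : ℝ}
    (h : Converges fun j => PowerSeries.coeff j ψ * ρ ^ j)
    (hU : |PowerSeries.constantCoeff U| < |ρ|) : CompSummable ψ U :=
  let ⟨_, hM⟩ := h.bounded
  compSummable_of_bounded hM hU

theorem constantCoeff_comp (ψ U : PowerSeries ℝ) : PowerSeries.constantCoeff (comp ψ U) =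
    ∑' j, PowerSeries.coeff j ψ * PowerSeries.constantCoeff U ^ j := by
  rw [← PowerSeries.coeff_zero_eq_constantCoeff_apply, comp, PowerSeries.coeff_mk]
  simp

theorem tendsto_completeBell {F : Filter ℝ} {c : ℝ → ℕ → ℝ} {d : ℕ → ℝ} {n : ℕ}
    (h : ∀ m ∈ Finset.Icc 1 n, Tendsto (fun θ => c θ m) F (𝓝 (d m))) :
    Tendsto (fun θ => completeBell (c θ) n) F (𝓝 (completeBell d n)) := by
  have key : ∀ k, ∀ i ≤ n, Tendsto (fun θ => PowerSeries.coeff i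
      (PowerSeries.mk (egfCoeff (c θ)) ^ k)) F
      (𝓝 (PowerSeries.coeff i (PowerSeries.mk (egfCoeff d) ^ k))) := by
    intro k
    induction k with
    | zero => simp [tendsto_const_nhds]
    | succ k ih =>
      intro i hi
      simp only [pow_succ, PowerSeries.coeff_mul]
      refine tendsto_finsetSum _ fun p hp => ?_
      have hp' := Finset.HasAntidiagonal.mem_antidiagonal.1 hp
      refine (ih p.1 (by omega)).mul ?_
      simp only [PowerSeries.coeff_mk, egfCoeff]
      split_ifs with h0
      · exact tendsto_const_nhds
      · exact (h p.2 (Finset.mem_Icc.2 ⟨by omega, by omega⟩)).div_const _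
  simp only [completeBell]
  split_ifs
  · exact tendsto_const_nhds
  · exact tendsto_finsetSum _ fun k _ => (key k n le_rfl).const_mul _

/-- The complete Bell equation for the power series `t^(-w) V(t) φ(U(t))`. -/
theorem completeBell_comp {φ U V H : PowerSeries ℝ} {w : ℕ} {γ : ℝ} (hφ : CompSummable φ U)
    (hH : V * comp φ U = PowerSeries.X ^ w * H) (hγ : PowerSeries.constantCoeff H = γ)
    (hγ0 : γ ≠ 0) {n r s : ℕ} (hr : 1 ≤ r) (hR : 1 ≤ n * r + s) :
    completeBell (fun m => s * (m.factorial / ((m * r : ℕ) : ℝ) *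
        ∑' j, PowerSeries.coeff j (φ ^ (m * r)) *
          PowerSeries.coeff (m + w * (m * r)) (V ^ (m * r) * U ^ j))) n =
      s * (n.factorial / (γ ^ s * ((n * r + s : ℕ) : ℝ)) *
        ∑' j, PowerSeries.coeff j (φ ^ (n * r + s)) *
          PowerSeries.coeff (n + w * (n * r + s)) (V ^ (n * r + s) * U ^ j)) := by
  have key : ∀ m R, ∑' j, PowerSeries.coeff j (φ ^ R) *
      PowerSeries.coeff (m + w * R) (V ^ R * U ^ j) = PowerSeries.coeff m (H ^ R) := by
    intro m R
    rw [(hφ.hasSum_mul_pow (V ^ R) R (m + w * R)).tsum_eq, ← mul_pow, hH, mul_pow, ← pow_mul,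
      PowerSeries.coeff_X_pow_mul]
  simp only [key]
  exact completeBell_coeff_pow hγ hγ0 hr hR fun m _ => rfl

/-- The complete Bell equation for `V(t) φ(U(t))` when `φ` converges at `U(0)`, possibly on the
boundary of its interval of convergence: the equation holds for `θ U` with `0 < θ < 1`, and Abel's
limit theorem applies to all series in it. -/
theorem completeBell_comp_of_converges {φ U V : PowerSeries ℝ} {n r s : ℕ} (hr : 1 ≤ r)
    (hR : 1 ≤ n * r + s)
    (hφ : Converges fun j => PowerSeries.coeff j φ * PowerSeries.constantCoeff U ^ j)
    (h0 : ∀ m ∈ Finset.Icc 1 n, Converges fun j => PowerSeries.coeff j (φ ^ (m * r)) *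
      PowerSeries.coeff m (V ^ (m * r) * U ^ j))
    (hs : Converges fun j => PowerSeries.coeff j (φ ^ (n * r + s)) *
      PowerSeries.coeff n (V ^ (n * r + s) * U ^ j)) {γ : ℝ}
    (hγ : γ = PowerSeries.constantCoeff V *
      seriesSum fun j => PowerSeries.coeff j φ * PowerSeries.constantCoeff U ^ j) (hγ0 : γ ≠ 0) :
    completeBell (fun m => s * (m.factorial / ((m * r : ℕ) : ℝ) *
        seriesSum fun j => PowerSeries.coeff j (φ ^ (m * r)) *
          PowerSeries.coeff m (V ^ (m * r) * U ^ j))) n =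
      s * (n.factorial / (γ ^ s * ((n * r + s : ℕ) : ℝ)) *
        seriesSum fun j => PowerSeries.coeff j (φ ^ (n * r + s)) *
          PowerSeries.coeff n (V ^ (n * r + s) * U ^ j)) := by
  have hsum : ∀ θ : ℝ, 0 < θ → θ < 1 → CompSummable φ (PowerSeries.C θ * U) := by
    intro θ hθ0 hθ1
    by_cases hU : PowerSeries.constantCoeff U = 0
    · exact compSummable_of_constantCoeff_eq_zero φ (by simp [hU])
    · refine compSummable_of_converges hφ ?_
      rw [map_mul, PowerSeries.constantCoeff_C, abs_mul, abs_of_pos hθ0]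
      exact mul_lt_of_lt_one_left (abs_pos.2 hU) hθ1
  have hscale : ∀ (θ : ℝ) (m R j : ℕ), PowerSeries.coeff j (φ ^ R) *
      PowerSeries.coeff m (V ^ R * (PowerSeries.C θ * U) ^ j) =
        PowerSeries.coeff j (φ ^ R) * PowerSeries.coeff m (V ^ R * U ^ j) * θ ^ j := by
    intro θ m R j
    rw [mul_pow, ← map_pow, mul_left_comm, PowerSeries.coeff_C_mul]
    ring
  set g : ℝ → ℝ := fun θ => PowerSeries.constantCoeff V *
    ∑' j, PowerSeries.coeff j φ * PowerSeries.constantCoeff U ^ j * θ ^ j with hg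
  have hgθ : ∀ θ : ℝ, PowerSeries.constantCoeff (V * comp φ (PowerSeries.C θ * U)) = g θ := by
    intro θ
    rw [map_mul, constantCoeff_comp, hg]
    congr 2
    funext j
    rw [map_mul, PowerSeries.constantCoeff_C, mul_pow]
    ring
  have hglim : Tendsto g (𝓝[<] 1) (𝓝 γ) := by
    rw [hγ]
    exact hφ.tendsto_abel.const_mul _
  have hlim1 := tendsto_completeBell (F := 𝓝[<] (1 : ℝ)) (n := n)
    (c := fun θ m => s * (m.factorial / ((m * r : ℕ) : ℝ) *
      ∑' j, PowerSeries.coeff j (φ ^ (m * r)) *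
        PowerSeries.coeff m (V ^ (m * r) * U ^ j) * θ ^ j))
    (fun m hm => ((h0 m hm).tendsto_abel.const_mul _).const_mul _)
  have hlim2 : Tendsto (fun θ => s * (n.factorial / (g θ ^ s * ((n * r + s : ℕ) : ℝ)) *
      ∑' j, PowerSeries.coeff j (φ ^ (n * r + s)) *
        PowerSeries.coeff n (V ^ (n * r + s) * U ^ j) * θ ^ j)) (𝓝[<] (1 : ℝ)) (𝓝 (s *
          (n.factorial / (γ ^ s * ((n * r + s : ℕ) : ℝ)) * seriesSum fun j =>
            PowerSeries.coeff j (φ ^ (n * r + s)) *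
              PowerSeries.coeff n (V ^ (n * r + s) * U ^ j)))) := by
    have hR0 : ((n * r + s : ℕ) : ℝ) ≠ 0 := by exact_mod_cast (by omega : n * r + s ≠ 0)
    refine ((Tendsto.div tendsto_const_nhds ((hglim.pow s).mul_const _) ?_).mul
      hs.tendsto_abel).const_mul _
    exact mul_ne_zero (pow_ne_zero _ hγ0) hR0
  refine tendsto_nhds_unique hlim1 (hlim2.congr' ?_)
  have hev : ∀ᶠ θ : ℝ in 𝓝[<] 1, 0 < θ :=
    nhdsWithin_le_nhds (lt_mem_nhds one_pos)
  filter_upwards [hev, self_mem_nhdsWithin, hglim.eventually_ne hγ0] with θ h1 h2 h3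
  have h4 := completeBell_comp (V := V) (w := 0) (hsum θ h1 h2)
    (H := V * comp φ (PowerSeries.C θ * U)) (by simp) (hgθ θ) h3 hr hR
  simp only [zero_mul, add_zero, hscale] at h4
  exact h4.symm

end BellBinomial

/-! ### The series of the theorem as coefficients of powers -/

namespace BellBinomial

theorem phiTerm_eq (c : ℕ → ℝ) (y : ℝ) :
    phiTerm c y = fun j => PowerSeries.coeff j (PowerSeries.mk (egfCoeff c)) * y ^ j := by
  funext j
  rw [phiTerm, PowerSeries.coeff_mk]

theorem partialBell_mul (c : ℕ → ℝ) (j R : ℕ) (d x : ℝ) :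
    partialBell c j R * d * (x ^ j / j.factorial) =
      (R.factorial : ℝ)⁻¹ *
        (PowerSeries.coeff j (PowerSeries.mk (egfCoeff c) ^ R) * (d * x ^ j)) := by
  rw [partialBell]
  have : (j.factorial : ℝ) ≠ 0 := by positivity
  field_simp

theorem IsBinomialType.powers_eq {f : ℕ → Polynomial ℝ} (hf : IsBinomialType f)
    (A : PowerSeries ℝ) (u v R j : ℕ) (x β lam : ℝ) :
    (A ^ v * egf f lam) ^ R * (PowerSeries.C x * (A ^ u * egf f β)) ^ j =
      PowerSeries.C (x ^ j) * (A ^ (j * u + v * R) * egf f (β * j + lam * R)) := by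
  rw [hf.egf_add, mul_comm β, mul_comm lam, hf.egf_nat_mul, hf.egf_nat_mul, map_pow]
  ring

/-- The terms for `α ≠ 0`, with `U = x (α + G)^u e^{β G}` and `V = (α + G)^v e^{lam G}`: up to
factorials the `j`-th one is `[y^j] φ^R * [t^m] (V^R U^j)`. -/
theorem expTerm_eq {f : ℕ → Polynomial ℝ} (hf : IsBinomialType f) (c : ℕ → ℝ) (r u v : ℕ)
    (x a α β lam : ℝ) (m q : ℕ) :
    expTerm f c r u v x a α β lam m q = fun j => m.factorial / (m * r + q).factorial *
      (PowerSeries.coeff j (PowerSeries.mk (egfCoeff c) ^ (m * r + q)) * PowerSeries.coeff m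
        (((PowerSeries.C α + exponent (shifted f a)) ^ v * egf (shifted f a) lam) ^ (m * r + q) *
          (PowerSeries.C x * ((PowerSeries.C α + exponent (shifted f a)) ^ u *
            egf (shifted f a) β)) ^ j)) := by
  funext j
  rw [expTerm, (hf.shifted a).iteratedDeriv_exp_mul_eval, partialBell_mul,
    (hf.shifted a).powers_eq, PowerSeries.coeff_C_mul, mul_zero, Real.exp_zero, add_zero]
  ring

/-- The terms for `α = 0` are of the same form, except that the coefficient of
`t^(m + (u + v) R)` is taken and the factor `m!` is absent. -/
theorem polyTerm_eq {f : ℕ → Polynomial ℝ} (hf : IsBinomialType f) (c : ℕ → ℝ) (r u v : ℕ)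
    (x a β lam : ℝ) (m q : ℕ) :
    polyTerm f c r u v x a β lam m q = fun j => ((m * r + q).factorial : ℝ)⁻¹ *
      (PowerSeries.coeff j (PowerSeries.mk (egfCoeff c) ^ (m * r + q)) * PowerSeries.coeff
        (m + (u + v) * (m * r + q)) ((exponent (shifted f a) ^ v * egf (shifted f a) lam) ^
          (m * r + q) * (PowerSeries.C x * (exponent (shifted f a) ^ u *
            egf (shifted f a) β)) ^ j)) := by
  funext j
  have h := (hf.shifted a).iteratedDeriv_exp_mul_eval 0 0 (m + (u + v) * (m * r + q))
    (j * u + v * (m * r + q)) (β * j + lam * (m * r + q : ℕ))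
  simp only [zero_mul, Real.exp_zero, one_mul, zero_add, map_zero] at h
  have hfac : ((m + (u + v) * (m * r + q)).factorial : ℝ) ≠ 0 := by positivity
  rw [polyTerm, h, partialBell_mul, (hf.shifted a).powers_eq, PowerSeries.coeff_C_mul,
    mul_div_cancel_left₀ _ hfac]
  ring

theorem CompSummable.summable_pow {φ U : PowerSeries ℝ} (h : CompSummable φ U) (b : ℝ)
    (V : PowerSeries ℝ) (R m : ℕ) : Summable fun j =>
      b * (PowerSeries.coeff j (φ ^ R) * PowerSeries.coeff m (V * U ^ j)) :=
  (h.hasSum_mul_pow V R m).summable.mul_left b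

theorem converges_phiTerm {c : ℕ → ℝ} {x ρ : ℝ} (hx : |x| < |ρ|)
    (hρ : Converges (phiTerm c ρ)) : Converges (phiTerm c x) := by
  rw [phiTerm_eq] at hρ ⊢
  have h := compSummable_of_converges (U := PowerSeries.C x) hρ (by simpa using hx) 0
  simp only [PowerSeries.coeff_zero_eq_constantCoeff, map_pow, PowerSeries.constantCoeff_C] at h
  exact (Converges.of_summable h).1

theorem Converges.of_mul_left {t : ℕ → ℝ} {b : ℝ} (hb : b ≠ 0)
    (h : Converges fun j => b * t j) : Converges t := by
  simpa [← mul_assoc, hb] using (h.mul_left b⁻¹).1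

/-- `completeBell_comp_of_converges` for series with terms normalized as in the definitions of
`Z(m, q)`. -/
theorem completeBell_of_terms {φ U V : PowerSeries ℝ} {n r s : ℕ} (hr : 1 ≤ r)
    (hR : 1 ≤ n * r + s) {t : ℕ → ℕ → ℕ → ℝ} {b : ℕ → ℝ} (hb : ∀ m, b m ≠ 0)
    (ht : ∀ m q, t m q = fun j => b m / (m * r + q).factorial * (PowerSeries.coeff j
      (φ ^ (m * r + q)) * PowerSeries.coeff m (V ^ (m * r + q) * U ^ j)))
    (hφ : Converges fun j => PowerSeries.coeff j φ * PowerSeries.constantCoeff U ^ j)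
    (h0 : ∀ m ∈ Finset.Icc 1 n, Converges (t m 0)) (hs : Converges (t n s)) {γ : ℝ}
    (hγ : γ = PowerSeries.constantCoeff V *
      seriesSum fun j => PowerSeries.coeff j φ * PowerSeries.constantCoeff U ^ j) (hγ0 : γ ≠ 0)
    {Z : ℕ → ℕ → ℝ} (hZ : ∀ m q, Z m q = m.factorial / b m * ((m * r + q).factorial /
      (γ ^ q * ((m * r + q : ℕ) : ℝ)) * seriesSum (t m q))) :
    completeBell (fun m => s * Z m 0) n = s * Z n s := by
  have hbR : ∀ m q : ℕ, b m / (m * r + q).factorial ≠ 0 :=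
    fun m q => div_ne_zero (hb m) (by positivity)
  have hT : ∀ m q : ℕ, Converges (t m q) → Converges fun j => PowerSeries.coeff j
      (φ ^ (m * r + q)) * PowerSeries.coeff m (V ^ (m * r + q) * U ^ j) := by
    intro m q h
    rw [ht] at h
    exact h.of_mul_left (hbR m q)
  have hZ' : ∀ m q : ℕ, Converges (t m q) → Z m q =
      m.factorial / (γ ^ q * ((m * r + q : ℕ) : ℝ)) * seriesSum fun j => PowerSeries.coeff j
        (φ ^ (m * r + q)) * PowerSeries.coeff m (V ^ (m * r + q) * U ^ j) := by
    intro m q h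
    have h1 : ((m * r + q).factorial : ℝ) ≠ 0 := by positivity
    have h2 := hb m
    rw [hZ, ht, ((hT m q h).mul_left _).2]
    field_simp
  have hmain := completeBell_comp_of_converges hr hR hφ
    (fun m hm => by simpa using hT m 0 (h0 m hm)) (hT n s hs) hγ hγ0
  rw [hZ' n s hs, ← hmain]
  refine completeBell_congr fun m hm => ?_
  rw [hZ' m 0 (h0 m hm)]
  simp

theorem completeBell_expZ {f : ℕ → Polynomial ℝ} (hf : IsBinomialType f) {c : ℕ → ℝ}
    {n r s u v : ℕ} (hr : 1 ≤ r) (hR : 1 ≤ n * r + s) {x a α β lam : ℝ}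
    (hφ : Converges (phiTerm c (x * α ^ u)))
    (h0 : ∀ m ∈ Finset.Icc 1 n, Converges (expTerm f c r u v x a α β lam m 0))
    (hs : Converges (expTerm f c r u v x a α β lam n s)) (hγ : expGamma c u v x α ≠ 0) :
    completeBell (fun m => s * expZ f c r u v x a α β lam m 0) n =
      s * expZ f c r u v x a α β lam n s := by
  have hU0 : PowerSeries.constantCoeff (PowerSeries.C x *
      ((PowerSeries.C α + exponent (shifted f a)) ^ u * egf (shifted f a) β)) = x * α ^ u := by
    simp [(hf.shifted a).constantCoeff_egf, (hf.shifted a).constantCoeff_exponent]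
  have hV0 : PowerSeries.constantCoeff
      ((PowerSeries.C α + exponent (shifted f a)) ^ v * egf (shifted f a) lam) = α ^ v := by
    simp [(hf.shifted a).constantCoeff_egf, (hf.shifted a).constantCoeff_exponent]
  refine completeBell_of_terms hr hR (b := fun m => m.factorial) (fun m => by positivity)
    (expTerm_eq hf c r u v x a α β lam) ?_ h0 hs (γ := expGamma c u v x α) ?_ hγ ?_
  · rwa [hU0, ← phiTerm_eq]
  · rw [hU0, hV0, ← phiTerm_eq, expGamma, phi]
  · intro m q
    rw [div_self (by positivity), one_mul, expZ]

/-- The exponent of the shifted sequence starts with `f_1'(0) t`. -/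
theorem exists_exponent_shifted_eq {f : ℕ → Polynomial ℝ} (hf : IsBinomialType f) (a : ℝ) :
    ∃ G : PowerSeries ℝ, exponent (shifted f a) = PowerSeries.X * G ∧
      PowerSeries.constantCoeff G = (Polynomial.derivative (f 1)).eval 0 := by
  obtain ⟨G, hG⟩ := PowerSeries.X_dvd_iff.2 (hf.shifted a).constantCoeff_exponent
  refine ⟨G, hG, ?_⟩
  have h1 : PowerSeries.coeff 1 (exponent (shifted f a)) = PowerSeries.constantCoeff G := by
    rw [hG, ← zero_add 1, PowerSeries.coeff_succ_X_mul,
      PowerSeries.coeff_zero_eq_constantCoeff_apply]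
  have h2 : (f 1).divX = Polynomial.C ((f 1).coeff 1) := by
    ext k
    rw [Polynomial.coeff_divX, Polynomial.coeff_C]
    split_ifs with hk
    · rw [hk]
    · exact Polynomial.coeff_eq_zero_of_natDegree_lt
        ((hf.natDegree_le 1).trans_lt (by omega))
  rw [← h1, exponent, PowerSeries.coeff_mk, shifted, if_neg one_ne_zero, h2, Polynomial.C_comp,
    Polynomial.coeff_X_mul, Polynomial.coeff_C_zero, ← Polynomial.coeff_zero_eq_eval_zero,
    Polynomial.coeff_derivative]
  simp

/-- The equation for `α = 0` and `u = 0`: the exponent `G` is divisible by `t`, so that `t^v`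
splits off from `V`, while `U(0) = x`. -/
theorem completeBell_polyZ_zero {f : ℕ → Polynomial ℝ} (hf : IsBinomialType f) {c : ℕ → ℝ}
    {n r s v : ℕ} (hr : 1 ≤ r) (hR : 1 ≤ n * r + s) {x a β lam : ℝ}
    (hφ : Converges (phiTerm c x))
    (h0 : ∀ m ∈ Finset.Icc 1 n, Converges (polyTerm f c r 0 v x a β lam m 0))
    (hs : Converges (polyTerm f c r 0 v x a β lam n s)) (hγ : polyGamma f c 0 v x ≠ 0) :
    completeBell (fun m => s * polyZ f c r 0 v x a β lam m 0) n =
      s * polyZ f c r 0 v x a β lam n s := by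
  obtain ⟨G, hG, hG0⟩ := exists_exponent_shifted_eq hf a
  set U := PowerSeries.C x * (exponent (shifted f a) ^ 0 * egf (shifted f a) β) with hU
  set V := G ^ v * egf (shifted f a) lam with hV
  have hU0 : PowerSeries.constantCoeff U = x := by
    simp [hU, (hf.shifted a).constantCoeff_egf]
  have hV0 : PowerSeries.constantCoeff V = (Polynomial.derivative (f 1)).eval 0 ^ v := by
    simp [hV, (hf.shifted a).constantCoeff_egf, hG0]
  have hterm : ∀ m q : ℕ, polyTerm f c r 0 v x a β lam m q = fun j =>
      ((m * r + q).factorial : ℝ)⁻¹ *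
        (PowerSeries.coeff j (PowerSeries.mk (egfCoeff c) ^ (m * r + q)) *
          PowerSeries.coeff m (V ^ (m * r + q) * U ^ j)) := by
    intro m q
    rw [polyTerm_eq hf]
    funext j
    have h1 : (exponent (shifted f a) ^ v * egf (shifted f a) lam) ^ (m * r + q) * U ^ j =
        PowerSeries.X ^ ((0 + v) * (m * r + q)) * (V ^ (m * r + q) * U ^ j) := by
      rw [hV, hG]
      ring
    rw [h1, PowerSeries.coeff_X_pow_mul]
  refine completeBell_of_terms hr hR (b := fun _ => 1) (fun _ => one_ne_zero)
    (fun m q => by rw [hterm, one_div]) ?_ h0 hs (γ := polyGamma f c 0 v x) ?_ hγ ?_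
  · rwa [hU0, ← phiTerm_eq]
  · rw [hU0, hV0, ← phiTerm_eq, polyGamma, if_neg (by omega), phi]
  · intro m q
    rw [div_one, polyZ, if_neg (by omega)]
    ring

/-- The equation for `α = 0` and `u ≥ 1`: now `U(0) = 0`, so that `φ(U)` is a formal composition
and no convergence is involved. -/
theorem completeBell_polyZ_pos {f : ℕ → Polynomial ℝ} (hf : IsBinomialType f) {c : ℕ → ℝ}
    {n r s u v : ℕ} (hr : 1 ≤ r) (hR : 1 ≤ n * r + s) (hu : 1 ≤ u) {x a β lam : ℝ}
    (hγ : polyGamma f c u v x ≠ 0) :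
    completeBell (fun m => s * polyZ f c r u v x a β lam m 0) n =
      s * polyZ f c r u v x a β lam n s := by
  obtain ⟨G, hG, hG0⟩ := exists_exponent_shifted_eq hf a
  set φ := PowerSeries.mk (egfCoeff c) with hφ
  set U' := PowerSeries.C x * (G ^ u * egf (shifted f a) β) with hU'
  set V' := G ^ v * egf (shifted f a) lam with hV'
  have hU : PowerSeries.C x * (exponent (shifted f a) ^ u * egf (shifted f a) β) =
      PowerSeries.X ^ u * U' := by
    rw [hU', hG]
    ring
  have hV : exponent (shifted f a) ^ v * egf (shifted f a) lam = PowerSeries.X ^ v * V' := by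
    rw [hV', hG]
    ring
  have hU0 : PowerSeries.constantCoeff (PowerSeries.X ^ u * U') = 0 := by
    rw [map_mul, map_pow, PowerSeries.constantCoeff_X, zero_pow (by omega), zero_mul]
  have hsum : CompSummable φ (PowerSeries.X ^ u * U') :=
    compSummable_of_constantCoeff_eq_zero φ hU0
  have hφ0 : PowerSeries.coeff 0 φ = 0 := by simp [hφ, egfCoeff]
  have hcoeff : ∀ i j : ℕ, i < u * j → PowerSeries.coeff i ((PowerSeries.X ^ u * U') ^ j) = 0 := by
    intro i j hij
    rw [mul_pow, ← pow_mul, PowerSeries.coeff_X_pow_mul', if_neg (by omega)]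
  -- `φ(U)` has the lowest term `c_1 x f_1'(0)^u t^u`
  obtain ⟨S, hS⟩ : PowerSeries.X ^ u ∣ comp φ (PowerSeries.X ^ u * U') := by
    rw [PowerSeries.X_pow_dvd_iff]
    intro i hi
    rw [comp, PowerSeries.coeff_mk]
    refine (tsum_congr fun j => ?_).trans tsum_zero
    rcases Nat.eq_zero_or_pos j with rfl | hj
    · rw [hφ0, zero_mul]
    · rw [hcoeff i j (hi.trans_le (Nat.le_mul_of_pos_right u hj)), mul_zero]
  have hS0 : PowerSeries.constantCoeff S =
      c 1 * (x * (Polynomial.derivative (f 1)).eval 0 ^ u) := by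
    have h1 : PowerSeries.coeff u (comp φ (PowerSeries.X ^ u * U')) =
        PowerSeries.constantCoeff S := by
      rw [hS]
      simpa using PowerSeries.coeff_X_pow_mul S u 0
    rw [← h1, comp, PowerSeries.coeff_mk, tsum_eq_single 1]
    · have h2 : PowerSeries.coeff u (PowerSeries.X ^ u * U') = PowerSeries.constantCoeff U' := by
        simpa using PowerSeries.coeff_X_pow_mul U' u 0
      rw [pow_one, h2, hφ, PowerSeries.coeff_mk, egfCoeff]
      simp [hU', hG0, (hf.shifted a).constantCoeff_egf]
    · intro j hj
      rcases Nat.eq_zero_or_pos j with rfl | hj0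
      · rw [hφ0, zero_mul]
      · have : u * 2 ≤ u * j := Nat.mul_le_mul_left u (by omega)
        rw [hcoeff u j (by omega), mul_zero]
  have hH : PowerSeries.X ^ v * V' * comp φ (PowerSeries.X ^ u * U') =
      PowerSeries.X ^ (u + v) * (V' * S) := by
    rw [hS]
    ring
  have hH0 : PowerSeries.constantCoeff (V' * S) = polyGamma f c u v x := by
    rw [map_mul, hS0, polyGamma, if_pos hu]
    simp only [hV', map_mul, map_pow, hG0, (hf.shifted a).constantCoeff_egf]
    ring
  have hZ : ∀ m q : ℕ, polyZ f c r u v x a β lam m q =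
      m.factorial / (polyGamma f c u v x ^ q * ((m * r + q : ℕ) : ℝ)) *
        ∑' j, PowerSeries.coeff j (φ ^ (m * r + q)) * PowerSeries.coeff
          (m + (u + v) * (m * r + q)) ((PowerSeries.X ^ v * V') ^ (m * r + q) *
            (PowerSeries.X ^ u * U') ^ j) := by
    intro m q
    have h1 : ((m * r + q).factorial : ℝ) ≠ 0 := by positivity
    rw [polyZ, if_pos hu, polyTerm_eq hf, hU, hV, ← hφ]
    set R := m * r + q
    rw [tsum_eq_sum (s := Finset.Icc R (m / u + R)), ← Finset.mul_sum]
    · field_simp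
    · intro j hj
      rcases lt_or_ge j R with hjR | hjR
      · have h2 : PowerSeries.X ^ R ∣ φ ^ R := pow_dvd_pow_of_dvd
          (PowerSeries.X_dvd_iff.2 (by simpa using hφ0)) R
        rw [PowerSeries.X_pow_dvd_iff.1 h2 j hjR, zero_mul]
      · have h2 : m / u < j - R := by
          rw [Finset.mem_Icc] at hj
          omega
        have h3 : m < u * (j - R) := by
          rwa [Nat.div_lt_iff_lt_mul (by omega), mul_comm] at h2
        have h4 : m + (u + v) * R < v * R + u * j := by
          obtain ⟨d, rfl⟩ := Nat.exists_eq_add_of_le hjR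
          rw [Nat.add_sub_cancel_left] at h3
          nlinarith
        have h5 : (PowerSeries.X ^ v * V') ^ R * (PowerSeries.X ^ u * U') ^ j =
            PowerSeries.X ^ (v * R + u * j) * (V' ^ R * U' ^ j) := by ring
        rw [h5, PowerSeries.coeff_X_pow_mul', if_neg (by omega), mul_zero]
  have hmain := completeBell_comp (n := n) (s := s) hsum hH hH0 hγ hr hR
  rw [hZ, ← hmain]
  refine completeBell_congr fun m hm => ?_
  rw [hZ]
  simp

end BellBinomial

theorem theorem4 (f : ℕ → Polynomial ℝ) (hf : BellBinomial.IsBinomialType f) (c : ℕ → ℝ)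
    (n r s u v : ℕ) (hr : 1 ≤ r) (hR : 1 ≤ n * r + s) (x a α β lam : ℝ) :
    -- the case `α ≠ 0`: absolute convergence inside the disc of convergence of `φ`, and the
    -- complete Bell equation whenever the series that occur in it converge
    (α ≠ 0 →
      ((∃ ρ : ℝ, |x * α ^ u| < |ρ| ∧ BellBinomial.Converges (BellBinomial.phiTerm c ρ)) →
        BellBinomial.Converges (BellBinomial.phiTerm c (x * α ^ u)) ∧
        ∀ m q : ℕ, Summable (BellBinomial.expTerm f c r u v x a α β lam m q)) ∧
      (BellBinomial.Converges (BellBinomial.phiTerm c (x * α ^ u)) →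
        (∀ m ∈ Finset.Icc 1 n,
          BellBinomial.Converges (BellBinomial.expTerm f c r u v x a α β lam m 0)) →
        BellBinomial.Converges (BellBinomial.expTerm f c r u v x a α β lam n s) →
        BellBinomial.expGamma c u v x α ≠ 0 →
        BellBinomial.completeBell
            (fun m => s * BellBinomial.expZ f c r u v x a α β lam m 0) n =
          s * BellBinomial.expZ f c r u v x a α β lam n s)) ∧
    -- the case `α = 0`; here infinite series occur only for `u = 0`
    ((u = 0 → (∃ ρ : ℝ, |x| < |ρ| ∧ BellBinomial.Converges (BellBinomial.phiTerm c ρ)) →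
        BellBinomial.Converges (BellBinomial.phiTerm c x) ∧
        ∀ m q : ℕ, Summable (BellBinomial.polyTerm f c r u v x a β lam m q)) ∧
      ((u = 0 → BellBinomial.Converges (BellBinomial.phiTerm c x) ∧
          (∀ m ∈ Finset.Icc 1 n,
            BellBinomial.Converges (BellBinomial.polyTerm f c r u v x a β lam m 0)) ∧
          BellBinomial.Converges (BellBinomial.polyTerm f c r u v x a β lam n s)) →
        BellBinomial.polyGamma f c u v x ≠ 0 →
        BellBinomial.completeBell
            (fun m => s * BellBinomial.polyZ f c r u v x a β lam m 0) n =
          s * BellBinomial.polyZ f c r u v x a β lam n s)) := by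
  open BellBinomial in
  refine ⟨fun _ => ⟨?_, completeBell_expZ hf hr hR⟩, ?_, ?_⟩
  · rintro ⟨ρ, hx, hρ⟩
    refine ⟨converges_phiTerm hx hρ, fun m q => ?_⟩
    rw [phiTerm_eq] at hρ
    rw [expTerm_eq hf]
    refine (compSummable_of_converges hρ ?_).summable_pow _ _ _ _
    simpa [(hf.shifted a).constantCoeff_exponent, (hf.shifted a).constantCoeff_egf] using hx
  · rintro rfl ⟨ρ, hx, hρ⟩
    refine ⟨converges_phiTerm hx hρ, fun m q => ?_⟩
    rw [phiTerm_eq] at hρ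
    rw [polyTerm_eq hf]
    refine (compSummable_of_converges hρ ?_).summable_pow _ _ _ _
    simpa [(hf.shifted a).constantCoeff_egf] using hx
  · intro h hγ
    rcases Nat.eq_zero_or_pos u with rfl | hu
    · obtain ⟨h1, h2, h3⟩ := h rfl
      exact completeBell_polyZ_zero hf hr hR h1 h2 h3 hγ
    · exact completeBell_polyZ_pos hf hr hR hu hγ
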